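/- For an integer $n\ge 0$ and $z\in\mathbb C$ let $$J_n(z)=\sum_{k=0}^\infty\frac{(-1)^k}{k!\,(n+k)!}\Big(\frac z2\Big)^{n+2k},\qquad I_n(z)=\sum_{k=0}^\infty\frac{1}{k!\,(n+k)!}\Big(\frac z2\Big)^{n+2k}$$ be the Bessel function and the modified Bessel function of the first kind, and let $\delta_{0n}$ be the Kronecker delta. Let $\alpha,\beta_1,\beta_2,\beta_3\in\mathbb C$ with $\operatorname{Re}\alpha>0$. Then the integral and the series below converge absolutely, and $$\int_0^\infty e^{-\alpha x}J_0(\beta_1\sqrt x)\,J_0(\beta_2\sqrt x)\,J_0(\beta_3\sqrt x)\,dx=\frac1\alpha\exp\Big(-\frac{\beta_1^2+\beta_2^2+\beta_3^2}{4\alpha}\Big)\sum_{n=0}^\infty(-1)^n(2-\delta_{0n})\,I_n\Big(\frac{\beta_1\beta_2}{2\alpha}\Big)I_n\Big(\frac{\beta_1\beta_3}{2\alpha}\Big)I_n\Big(\frac{\beta_2\beta_3}{2\alpha}\Big).$$ This generalizes the case $\nu=0$ of Weber's second exponential integral, which is the case $\beta_3=0$ after the substitution $x\mapsto x^2$: the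 integral $$\int_0^\infty x\,e^{-\alpha x^2}J_0(\beta_1x)\,J_0(\beta_2x)\,dx=\frac1{2\alpha}\exp\Big(-\frac{\beta_1^2+\beta_2^2}{4\alpha}\Big)I_0\Big(\frac{\beta_1\beta_2}{2\alpha}\Big)$$ also converges absolutely and has the stated value. -/

import Mathlib

open MeasureTheory Set

/-- The Bessel function of the first kind `J_n(z)` of integer order `n ≥ 0`, at a complex `z`. -/
noncomputable def besselJ (n : ℕ) (z : ℂ) : ℂ :=
  ∑' k : ℕ, (-1 : ℂ) ^ k / ((k.factorial : ℂ) * ((n + k).factorial : ℂ)) * (z / 2) ^ (n + 2 * k)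

/-- The modified Bessel function of the first kind `I_n(z)` of integer order `n ≥ 0`, at a
complex `z`. -/
noncomputable def besselI (n : ℕ) (z : ℂ) : ℂ :=
  ∑' k : ℕ, 1 / ((k.factorial : ℂ) * ((n + k).factorial : ℂ)) * (z / 2) ^ (n + 2 * k)

/-- The series of `I_n(z)` converges absolutely for every `z`. -/
theorem summable_norm_besselI (n : ℕ) (z : ℂ) :
    Summable fun k : ℕ =>
      ‖1 / ((k.factorial : ℂ) * ((n + k).factorial : ℂ)) * (z / 2) ^ (n + 2 * k)‖ := by
  have h := (Real.summable_pow_div_factorial (‖z / 2‖ ^ 2)).mul_left (‖z / 2‖ ^ n)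
  refine Summable.of_nonneg_of_le (fun k => norm_nonneg _) (fun k => ?_) h
  have h1 : (1 : ℝ) ≤ ((n + k).factorial : ℝ) := by
    exact_mod_cast Nat.succ_le_of_lt (Nat.factorial_pos (n + k))
  have h2 : (0 : ℝ) < (k.factorial : ℝ) := by exact_mod_cast Nat.factorial_pos k
  have h3 : 1 / ((k.factorial : ℝ) * ((n + k).factorial : ℝ)) ≤ 1 / (k.factorial : ℝ) :=
    one_div_le_one_div_of_le h2 (le_mul_of_one_le_right h2.le h1)
  calc ‖1 / ((k.factorial : ℂ) * ((n + k).factorial : ℂ)) * (z / 2) ^ (n + 2 * k)‖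
      = 1 / ((k.factorial : ℝ) * ((n + k).factorial : ℝ)) * ‖z / 2‖ ^ (n + 2 * k) := by
        simp only [norm_mul, norm_div, norm_one, norm_pow, Complex.norm_natCast]
    _ ≤ 1 / (k.factorial : ℝ) * ‖z / 2‖ ^ (n + 2 * k) := by gcongr
    _ = ‖z / 2‖ ^ n * ((‖z / 2‖ ^ 2) ^ k / (k.factorial : ℝ)) := by
        rw [pow_add, pow_mul]; ring

/-- The series of `J_n(z)` converges absolutely for every `z`. -/
theorem summable_norm_besselJ (n : ℕ) (z : ℂ) :
    Summable fun k : ℕ =>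
      ‖(-1 : ℂ) ^ k / ((k.factorial : ℂ) * ((n + k).factorial : ℂ)) * (z / 2) ^ (n + 2 * k)‖ := by
  refine (summable_norm_besselI n z).congr fun k => ?_
  simp only [norm_mul, norm_div, norm_one, norm_pow, norm_neg, one_pow]

/-!
The power series of `J₀(β₁√x) J₀(β₂√x) J₀(β₃√x)` is `∑ d_N (-x)^N`, where `d_N` is the sum of
`a^i b^j c^k / (i! j! k!)²` over `i + j + k = N`, with `a`, `b`, `c` the squares of `u = β₁/2`,
`v = β₂/2`, `w = β₃/2`. The identity rests on the observation that `N!² d_N`, a sum of squares of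
trinomial coefficients times monomials, is the constant term of `(S S')^N`, where
`S = u t + v s + w` and `S' = u t⁻¹ + v s⁻¹ + w`; that is, its average over the torus
`|t| = |s| = 1` (`torus_integral_eq_coeff`).

Since the Laplace transform of `x^N` is `N! / α^(N+1)`, integrating term by term turns the left-hand
side into `1/α` times the torus average of `exp (-S S' / α)` (`bessel_triple_laplace`). The same moment
formula bounds `d_N` by `M^N / N!²`, which makes all these series converge absolutely.

On the other hand, `S S' = u² + v² + w² + uv (t s⁻¹ + t⁻¹ s) + uw (t + t⁻¹) + vw (s + s⁻¹)`. The
diagonal part gives the exponential prefactor. Each cross term is expanded with the generating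
function `exp (x (t + t⁻¹) / 2) = ∑ I_|n|(x) tⁿ` over the integers (`hasSum_besselI_mul_zpow`), and by
orthogonality of characters the average is `∑ (-1)ⁿ I_|n| I_|n| I_|n|` (`hasSum_torus_integral_exp`).
Folding the integers onto the naturals produces the weights `2 - δ₀ₙ`.
-/

/-! ### Integration over the circle -/

/-- The point `exp (2πiθ)` of the unit circle, as a complex number. -/
noncomputable def circlePoint (θ : UnitAddCircle) : ℂ := AddCircle.toCircle θ

theorem circlePoint_ne_zero (θ : UnitAddCircle) : circlePoint θ ≠ 0 := Circle.coe_ne_zero _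

theorem norm_circlePoint (θ : UnitAddCircle) : ‖circlePoint θ‖ = 1 := Circle.norm_coe _

open AddCircle in
/-- Orthogonality of characters: the half-period translation attached to `n ≠ 0` changes the sign of
the integrand. -/
theorem integral_circlePoint_zpow (n : ℤ) :
    ∫ θ : UnitAddCircle, circlePoint θ ^ n ∂haarAddCircle = if n = 0 then 1 else 0 := by
  have hf : ∀ θ : UnitAddCircle, circlePoint θ ^ n = fourier n θ := fun θ => by
    rw [fourier_apply, toCircle_zsmul, Circle.coe_zpow, circlePoint]
  simp_rw [hf]
  split_ifs with hn
  · subst hn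
    simp only [fourier_zero, integral_const, probReal_univ, one_smul]
  · have h := integral_add_right_eq_self (μ := haarAddCircle (T := (1 : ℝ)))
      (fun θ => (fourier n θ : ℂ)) (((1 : ℝ) / 2 / n : ℝ) : AddCircle (1 : ℝ))
    simp_rw [fourier_add_half_inv_index hn one_pos] at h
    rw [integral_neg] at h
    exact self_eq_neg.mp h.symm

theorem hasSum_integral_of_norm_le_summable {X : Type*} [TopologicalSpace X]
    [SecondCountableTopology X] [MeasurableSpace X] [OpensMeasurableSpace X] (μ : Measure X)
    [IsFiniteMeasure μ] {ι : Type*} [Countable ι] {f : ι → X → ℂ} {F : X → ℂ} {b : ι → ℝ}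
    (hf : ∀ i, Continuous (f i)) (hb : Summable b) (hfb : ∀ i x, ‖f i x‖ ≤ b i)
    (hF : ∀ x, HasSum (fun i => f i x) (F x)) :
    HasSum (fun i => ∫ x, f i x ∂μ) (∫ x, F x ∂μ) :=
  hasSum_integral_of_dominated_convergence (fun i _ => b i)
    (fun i => (hf i).aestronglyMeasurable) (fun i => ae_of_all _ (hfb i))
    (ae_of_all _ fun _ => hb) (integrable_const _) (ae_of_all _ hF)

theorem continuous_circlePoint :
    Continuous fun θ : UnitAddCircle => circlePoint θ :=
  continuous_subtype_val.comp AddCircle.continuous_toCircle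

theorem continuous_circlePoint_zpow (n : ℤ) :
    Continuous fun θ : UnitAddCircle => circlePoint θ ^ n :=
  continuous_circlePoint.zpow₀ n fun _ => Or.inl (circlePoint_ne_zero _)

/-! ### The generating function of the modified Bessel functions -/

/-- Reindexing of pairs of naturals by their difference and their minimum. It turns a double power
series in `t` and `t⁻¹` into a Laurent series in `t`. -/
def prodNatEquivIntProdNat : ℕ × ℕ ≃ ℤ × ℕ where
  toFun p := ((p.1 : ℤ) - p.2, min p.1 p.2)
  invFun q := (q.2 + q.1.toNat, q.2 + (-q.1).toNat)
  left_inv p := by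
    rcases p with ⟨i, j⟩
    simp only [Prod.mk.injEq]
    omega
  right_inv q := by
    rcases q with ⟨n, k⟩
    simp only [Prod.mk.injEq]
    omega

theorem hasSum_besselI (n : ℕ) (z : ℂ) :
    HasSum (fun k : ℕ => 1 / ((k.factorial : ℂ) * ((n + k).factorial : ℂ)) * (z / 2) ^ (n + 2 * k))
      (besselI n z) :=
  (summable_norm_besselI n z).of_norm.hasSum

theorem hasSum_exp (z : ℂ) :
    HasSum (fun k : ℕ => z ^ k / (k.factorial : ℂ)) (Complex.exp z) := by
  rw [Complex.exp_eq_exp_ℂ]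
  exact NormedSpace.expSeries_div_hasSum_exp z

/-- The Laurent expansion `exp (x (t + t⁻¹) / 2) = ∑ₙ I_|n|(x) tⁿ`: multiply the exponential series
in `t` and in `t⁻¹` and collect the terms with the same difference of exponents. -/
theorem hasSum_besselI_mul_zpow (x : ℂ) {t : ℂ} (ht : t ≠ 0) :
    HasSum (fun n : ℤ => besselI n.natAbs x * t ^ n) (Complex.exp (x / 2 * (t + t⁻¹))) := by
  set y := x / 2 with hy
  have hS : ∀ z : ℂ, Summable fun k : ℕ => ‖z ^ k / (k.factorial : ℂ)‖ := fun z =>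
    (hasSum_exp z).summable.norm
  have hp : Summable fun p : ℕ × ℕ => (y * t) ^ p.1 / (p.1.factorial : ℂ) *
      ((y * t⁻¹) ^ p.2 / (p.2.factorial : ℂ)) :=
    summable_mul_of_summable_norm (f := fun k : ℕ => (y * t) ^ k / (k.factorial : ℂ))
      (g := fun k : ℕ => (y * t⁻¹) ^ k / (k.factorial : ℂ)) (hS _) (hS _)
  have h1 := (hasSum_exp (y * t)).mul (hasSum_exp (y * t⁻¹)) hp
  rw [← Complex.exp_add, ← mul_add, ← prodNatEquivIntProdNat.symm.hasSum_iff] at h1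
  -- On the fibre over `n` the smaller exponent `k` runs through the series of `I_|n|`.
  refine h1.prod_fiberwise fun n => ?_
  refine ((hasSum_besselI n.natAbs x).mul_right (t ^ n)).congr_fun fun k => ?_
  obtain ⟨m, rfl | rfl⟩ := n.eq_nat_or_neg
  · simp only [prodNatEquivIntProdNat, Equiv.coe_fn_symm_mk, Function.comp_apply, Int.toNat_natCast,
      Int.toNat_neg_natCast, Int.natAbs_natCast, zpow_natCast, add_zero, mul_pow, ← hy]
    have h3 : t ^ (k + m) * t⁻¹ ^ k = t ^ m := by
      rw [inv_pow, pow_add]; field_simp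
    rw [← h3, add_comm m k]
    ring
  · simp only [prodNatEquivIntProdNat, Equiv.coe_fn_symm_mk, Function.comp_apply, Int.toNat_natCast,
      Int.toNat_neg_natCast, Int.natAbs_neg, neg_neg, Int.natAbs_natCast, zpow_neg, zpow_natCast,
      add_zero, mul_pow, ← hy]
    have h3 : t ^ k * t⁻¹ ^ (k + m) = (t ^ m)⁻¹ := by
      rw [inv_pow, pow_add]; field_simp
    rw [← h3, add_comm m k]
    ring

theorem summable_norm_besselI_natAbs (x : ℂ) : Summable fun n : ℤ => ‖besselI n.natAbs x‖ := by
  simpa only [one_zpow, mul_one] using (hasSum_besselI_mul_zpow x one_ne_zero).summable.norm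

/-- The Laurent expansion of the generating function at `-t` in place of `t`. -/
theorem hasSum_neg_one_zpow_besselI (x : ℂ) {t : ℂ} (ht : t ≠ 0) :
    HasSum (fun n : ℤ => (-1 : ℂ) ^ n * besselI n.natAbs x * t ^ n)
      (Complex.exp (-(x / 2 * (t + t⁻¹)))) := by
  convert! hasSum_besselI_mul_zpow x (neg_ne_zero.mpr ht) using 1
  · ext n
    rw [neg_eq_neg_one_mul t, mul_zpow]
    ring
  · rw [inv_neg]
    ring_nf

theorem norm_neg_one_zpow_mul_besselI (n : ℤ) (x : ℂ) :
    ‖(-1 : ℂ) ^ n * besselI n.natAbs x‖ = ‖besselI n.natAbs x‖ := by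
  rw [norm_mul, norm_zpow, norm_neg, norm_one, one_zpow, one_mul]

/-- The Fourier coefficients of `exp (-x cos)`. -/
theorem integral_zpow_mul_exp (x : ℂ) (m : ℤ) :
    ∫ θ : UnitAddCircle, circlePoint θ ^ m *
      Complex.exp (-(x / 2 * (circlePoint θ + (circlePoint θ)⁻¹)))
        ∂AddCircle.haarAddCircle = (-1 : ℂ) ^ m * besselI m.natAbs x := by
  have h := hasSum_integral_of_norm_le_summable (AddCircle.haarAddCircle (T := (1 : ℝ)))
    (f := fun (n : ℤ) (θ : UnitAddCircle) => (-1 : ℂ) ^ n * besselI n.natAbs x *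
      circlePoint θ ^ (m + n))
    (F := fun θ => circlePoint θ ^ m *
      Complex.exp (-(x / 2 * (circlePoint θ + (circlePoint θ)⁻¹))))
    (fun n => continuous_const.mul (continuous_circlePoint_zpow _))
    (summable_norm_besselI_natAbs x) (fun n θ => ?_) (fun θ => ?_)
  · refine h.unique ?_
    simp_rw [integral_const_mul, integral_circlePoint_zpow]
    convert! hasSum_ite_eq (-m) ((-1 : ℂ) ^ m * besselI m.natAbs x) using 2 with n
    by_cases hn : n = -m
    · subst hn
      simp [zpow_neg, ← inv_zpow, inv_neg]
    · rw [if_neg hn, if_neg (by omega), mul_zero]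
  · rw [norm_mul, norm_neg_one_zpow_mul_besselI, norm_zpow, norm_circlePoint, one_zpow, mul_one]
  · refine ((hasSum_neg_one_zpow_besselI x
      (circlePoint_ne_zero θ)).mul_left _).congr_fun fun n => ?_
    rw [zpow_add₀ (circlePoint_ne_zero _)]
    ring

/-! ### Averages over the torus -/

/-- The torus average of three exponentials whose angles are `θ - η`, `θ` and `η`. Expanding the
first one in powers of `t s⁻¹` separates the variables, and each factor is then a Fourier coefficient
of one of the other two. -/
theorem hasSum_torus_integral_exp (x y z : ℂ) :
    HasSum (fun n : ℤ => (-1 : ℂ) ^ n *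
        (besselI n.natAbs x * besselI n.natAbs y * besselI n.natAbs z))
      (∫ p : UnitAddCircle × UnitAddCircle,
        Complex.exp (-(x / 2 * (circlePoint p.1 * (circlePoint p.2)⁻¹ +
            (circlePoint p.1 * (circlePoint p.2)⁻¹)⁻¹))) *
        (Complex.exp (-(y / 2 * (circlePoint p.1 + (circlePoint p.1)⁻¹))) *
        Complex.exp (-(z / 2 * (circlePoint p.2 + (circlePoint p.2)⁻¹))))
        ∂(AddCircle.haarAddCircle.prod AddCircle.haarAddCircle)) := by
  have hc : ∀ w : ℂ, Continuous fun θ : UnitAddCircle =>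
      Complex.exp (-(w / 2 * (circlePoint θ + (circlePoint θ)⁻¹))) :=
    fun w => Complex.continuous_exp.comp (continuous_const.mul (continuous_circlePoint.add
      (continuous_circlePoint.inv₀ fun _ => circlePoint_ne_zero _))).neg
  have hb : ∀ (w : ℂ) (θ : UnitAddCircle), ‖Complex.exp
      (-(w / 2 * (circlePoint θ + (circlePoint θ)⁻¹)))‖ ≤
        Real.exp ‖w‖ := fun w θ => by
    refine (Complex.norm_exp_le_exp_norm _).trans (Real.exp_le_exp.mpr ?_)
    rw [norm_neg, norm_mul, norm_div, Complex.norm_ofNat]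
    have := norm_add_le (circlePoint θ) (circlePoint θ)⁻¹
    rw [norm_inv, norm_circlePoint] at this
    linarith [mul_le_mul_of_nonneg_left this (norm_nonneg w)]
  have h := hasSum_integral_of_norm_le_summable
    ((AddCircle.haarAddCircle (T := (1 : ℝ))).prod (AddCircle.haarAddCircle (T := (1 : ℝ))))
    (b := fun n : ℤ => ‖besselI n.natAbs x‖ * (Real.exp ‖y‖ * Real.exp ‖z‖))
    (f := fun (n : ℤ) p => (-1 : ℂ) ^ n * besselI n.natAbs x *
      ((circlePoint p.1 ^ n *
        Complex.exp (-(y / 2 * (circlePoint p.1 + (circlePoint p.1)⁻¹)))) *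
      (circlePoint p.2 ^ (-n) *
        Complex.exp (-(z / 2 * (circlePoint p.2 + (circlePoint p.2)⁻¹))))))
    (F := fun p =>
      Complex.exp (-(x / 2 * (circlePoint p.1 * (circlePoint p.2)⁻¹ +
          (circlePoint p.1 * (circlePoint p.2)⁻¹)⁻¹))) *
      (Complex.exp (-(y / 2 * (circlePoint p.1 + (circlePoint p.1)⁻¹))) *
      Complex.exp (-(z / 2 * (circlePoint p.2 + (circlePoint p.2)⁻¹)))))
    (fun n => ?_) ((summable_norm_besselI_natAbs x).mul_right _) (fun n p => ?_)
    (fun p => ?_)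
  rotate_left
  · exact continuous_const.mul
      ((((continuous_circlePoint_zpow n).mul (hc y)).comp continuous_fst).mul
        (((continuous_circlePoint_zpow (-n)).mul (hc z)).comp continuous_snd))
  · simp only [norm_mul, norm_zpow, norm_circlePoint, norm_neg, norm_one, one_zpow, one_mul]
    gcongr <;> exact hb _ _
  · refine ((hasSum_neg_one_zpow_besselI x (mul_ne_zero (circlePoint_ne_zero p.1)
      (inv_ne_zero (circlePoint_ne_zero p.2)))).mul_right _).congr_fun
        fun n => ?_
    rw [mul_zpow, inv_zpow, zpow_neg]
    ring
  · refine h.congr_fun fun n => ?_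
    rw [integral_const_mul,
      integral_prod_mul
        (fun θ => circlePoint θ ^ n *
          Complex.exp (-(y / 2 * (circlePoint θ + (circlePoint θ)⁻¹))))
        (fun θ => circlePoint θ ^ (-n) *
          Complex.exp (-(z / 2 * (circlePoint θ + (circlePoint θ)⁻¹)))),
      integral_zpow_mul_exp, integral_zpow_mul_exp, Int.natAbs_neg, zpow_neg, ← inv_zpow, inv_neg, inv_one]
    -- The three signs `(-1)ⁿ` multiply to a single one.
    have h1 : (-1 : ℂ) ^ n * (-1 : ℂ) ^ n = 1 := by
      rw [← mul_zpow]; norm_num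
    linear_combination (-(-1 : ℂ) ^ n * (besselI n.natAbs x * besselI n.natAbs y *
      besselI n.natAbs z)) * h1

/-- Only the diagonal terms of the product of the two binomial expansions have a nonzero average. -/
theorem integral_binomial_mul_binomial (p q u : ℂ) (N : ℕ) :
    ∫ θ : UnitAddCircle, (p + u * circlePoint θ) ^ N *
        (q + u * (circlePoint θ)⁻¹) ^ N ∂AddCircle.haarAddCircle =
      ∑ j ∈ Finset.range (N + 1), (N.choose j : ℂ) ^ 2 * (u ^ 2) ^ j * (p * q) ^ (N - j) := by
  have h : ∀ θ : UnitAddCircle, (p + u * circlePoint θ) ^ N *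
        (q + u * (circlePoint θ)⁻¹) ^ N =
      ∑ i ∈ Finset.range (N + 1), ∑ j ∈ Finset.range (N + 1),
        u ^ i * p ^ (N - i) * N.choose i * (u ^ j * q ^ (N - j) * N.choose j) *
          circlePoint θ ^ ((i : ℤ) - j) := fun θ => by
    rw [add_comm p, add_comm q, add_pow, add_pow, Finset.sum_mul_sum]
    refine Finset.sum_congr rfl fun i _ => Finset.sum_congr rfl fun j _ => ?_
    rw [zpow_sub₀ (circlePoint_ne_zero _), zpow_natCast, zpow_natCast, mul_pow, mul_pow, inv_pow]
    ring
  have hi : ∀ (c : ℂ) (n : ℤ), Integrable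
      (fun θ : UnitAddCircle => c * circlePoint θ ^ n) AddCircle.haarAddCircle :=
    fun c n => (continuous_const.mul (continuous_circlePoint_zpow n)).integrable_of_hasCompactSupport
      (HasCompactSupport.of_compactSpace _)
  simp_rw [h]
  rw [integral_finsetSum _ fun i _ => integrable_finsetSum _ fun j _ => hi _ _]
  refine Finset.sum_congr rfl fun i hi' => ?_
  rw [integral_finsetSum _ fun j _ => hi _ _]
  simp_rw [integral_const_mul, integral_circlePoint_zpow]
  rw [Finset.sum_eq_single_of_mem i hi']
  · rw [if_pos (sub_self _)]
    ring
  · intro j _ hj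
    rw [if_neg (by omega), mul_zero]

theorem continuous_circle_form (u v w : ℂ) :
    Continuous fun p : UnitAddCircle × UnitAddCircle =>
      (u * circlePoint p.1 + v * circlePoint p.2 + w) *
          (u * (circlePoint p.1)⁻¹ + v * (circlePoint p.2)⁻¹ + w) := by
  have hinv : Continuous fun θ : UnitAddCircle => (circlePoint θ)⁻¹ :=
    continuous_circlePoint.inv₀ fun _ => circlePoint_ne_zero _
  have h3 := continuous_circlePoint.comp (continuous_fst (X := UnitAddCircle) (Y := UnitAddCircle))
  have h4 := continuous_circlePoint.comp (continuous_snd (X := UnitAddCircle) (Y := UnitAddCircle))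
  have h5 := hinv.comp (continuous_fst (X := UnitAddCircle) (Y := UnitAddCircle))
  have h6 := hinv.comp (continuous_snd (X := UnitAddCircle) (Y := UnitAddCircle))
  simp only [Function.comp_def] at h3 h4 h5 h6
  fun_prop

/-- Torus average of `(S S')^N`, with `S = u t + v s + w` and `S' = u t⁻¹ + v s⁻¹ + w`: two
successive applications of the one-variable average, first in the second coordinate and then in the
first. -/
theorem torus_integral_trinomial (u v w : ℂ) (N : ℕ) :
    ∫ p : UnitAddCircle × UnitAddCircle,
        ((u * circlePoint p.1 + v * circlePoint p.2 + w) *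
          (u * (circlePoint p.1)⁻¹ + v * (circlePoint p.2)⁻¹ + w)) ^ N
        ∂(AddCircle.haarAddCircle.prod AddCircle.haarAddCircle) =
      ∑ j ∈ Finset.range (N + 1), (N.choose j : ℂ) ^ 2 * (v ^ 2) ^ j *
        ∑ i ∈ Finset.range (N - j + 1), ((N - j).choose i : ℂ) ^ 2 * (u ^ 2) ^ i *
          (w ^ 2) ^ (N - j - i) := by
  have h1 := continuous_circlePoint
  have hinv : Continuous fun θ : UnitAddCircle => (circlePoint θ)⁻¹ :=
    continuous_circlePoint.inv₀ fun _ => circlePoint_ne_zero _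
  rw [integral_prod]
  · have h2 : ∀ θ : UnitAddCircle, ∫ η : UnitAddCircle,
        ((u * circlePoint θ + v * circlePoint η + w) *
          (u * (circlePoint θ)⁻¹ + v * (circlePoint η)⁻¹ + w)) ^ N
          ∂AddCircle.haarAddCircle = ∑ j ∈ Finset.range (N + 1), (N.choose j : ℂ) ^ 2 *
            (v ^ 2) ^ j * ((w + u * circlePoint θ) ^ (N - j) *
              (w + u * (circlePoint θ)⁻¹) ^ (N - j)) := fun θ => by
      simp_rw [← mul_pow (w + _), ← integral_binomial_mul_binomial, ← mul_pow]
      refine integral_congr_ae (ae_of_all _ fun η => ?_)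
      ring
    simp_rw [h2]
    rw [integral_finsetSum]
    · simp_rw [integral_const_mul, integral_binomial_mul_binomial, ← pow_two w]
    · intro j _
      refine Continuous.integrable_of_hasCompactSupport ?_ (HasCompactSupport.of_compactSpace _)
      fun_prop
  · exact ((continuous_circle_form u v w).pow N).integrable_of_hasCompactSupport
      (HasCompactSupport.of_compactSpace _)

/-! ### Laplace transforms of power series -/

theorem integrableOn_pow_mul_exp_neg_mul {r : ℝ} (hr : 0 < r) (N : ℕ) :
    IntegrableOn (fun x : ℝ => x ^ N * Real.exp (-r * x)) (Ioi 0) := by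
  simpa only [Real.rpow_natCast, Real.rpow_one] using
    integrableOn_rpow_mul_exp_neg_mul_rpow (p := 1) (s := N) (b := r)
      (by linarith [Nat.cast_nonneg (α := ℝ) N]) one_pos hr

theorem integral_pow_mul_exp_neg_mul {r : ℝ} (hr : 0 < r) (N : ℕ) :
    ∫ x : ℝ in Ioi 0, x ^ N * Real.exp (-r * x) = N.factorial / r ^ (N + 1) := by
  have h := Real.integral_rpow_mul_exp_neg_mul_Ioi (a := (N : ℝ) + 1) (by positivity) hr
  rw [add_sub_cancel_right, Real.Gamma_nat_eq_factorial, ← Nat.cast_succ, Real.rpow_natCast] at h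
  simp only [Real.rpow_natCast, ← neg_mul] at h
  rw [h, one_div, inv_pow, mul_comm, div_eq_mul_inv]

theorem norm_pow_mul_cexp (α : ℂ) (N : ℕ) {x : ℝ} (hx : 0 ≤ x) :
    ‖(x : ℂ) ^ N * Complex.exp (-α * x)‖ = x ^ N * Real.exp (-α.re * x) := by
  rw [norm_mul, norm_pow, Complex.norm_real, Real.norm_of_nonneg hx, Complex.norm_exp]
  simp

theorem integrableOn_pow_mul_cexp_neg_mul {α : ℂ} (hα : 0 < α.re) (N : ℕ) :
    IntegrableOn (fun x : ℝ => (x : ℂ) ^ N * Complex.exp (-α * x)) (Ioi 0) := by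
  refine (integrableOn_pow_mul_exp_neg_mul hα N).mono' ?_ ?_
  · refine Continuous.aestronglyMeasurable ?_
    fun_prop
  · exact (ae_restrict_mem measurableSet_Ioi).mono fun x hx =>
      (norm_pow_mul_cexp α N (le_of_lt hx)).le

open Filter Topology in
/-- Mathlib has the Gamma integral with a real rate only. For complex `α` the induction step integrates
the derivative of `x^(N+1) e^(-αx)`, which vanishes at both ends. -/
theorem integral_pow_mul_cexp_neg_mul {α : ℂ} (hα : 0 < α.re) (N : ℕ) :
    ∫ x : ℝ in Ioi 0, (x : ℂ) ^ N * Complex.exp (-α * x) = N.factorial / α ^ (N + 1) := by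
  have hα0 : α ≠ 0 := fun h => by simp [h] at hα
  induction N with
  | zero =>
    simp_rw [pow_zero, one_mul]
    rw [integral_exp_mul_complex_Ioi (by simpa using hα)]
    simp [neg_div_neg_eq]
  | succ N ih =>
    have hd : ∀ x ∈ Ici (0 : ℝ), HasDerivAt
        (fun x : ℝ => (x : ℂ) ^ (N + 1) * Complex.exp (-α * x))
        ((N + 1 : ℂ) * ((x : ℂ) ^ N * Complex.exp (-α * x)) +
          -α * ((x : ℂ) ^ (N + 1) * Complex.exp (-α * x))) x := fun x _ => by
      have h1 : HasDerivAt (fun z : ℂ => z ^ (N + 1) * Complex.exp (-α * z))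
          (((N + 1 : ℕ) : ℂ) * (x : ℂ) ^ N * Complex.exp (-α * x) +
            (x : ℂ) ^ (N + 1) * (Complex.exp (-α * x) * (-α * 1))) (x : ℂ) :=
        (hasDerivAt_pow (N + 1) (x : ℂ)).mul (((hasDerivAt_id (x : ℂ)).const_mul (-α)).cexp)
      refine h1.comp_ofReal.congr_deriv ?_
      push_cast
      ring
    have ht : Tendsto (fun x : ℝ => (x : ℂ) ^ (N + 1) * Complex.exp (-α * x)) atTop (𝓝 0) := by
      rw [tendsto_zero_iff_norm_tendsto_zero]
      refine (tendsto_rpow_mul_exp_neg_mul_atTop_nhds_zero ((N + 1 : ℕ) : ℝ) α.re hα).congr' ?_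
      filter_upwards [eventually_ge_atTop 0] with x hx
      rw [norm_pow_mul_cexp α _ hx, Real.rpow_natCast]
    have hi1 := (integrableOn_pow_mul_cexp_neg_mul hα N).const_mul (N + 1 : ℂ)
    have hi2 := (integrableOn_pow_mul_cexp_neg_mul hα (N + 1)).const_mul (-α)
    have h := integral_Ioi_of_hasDerivAt_of_tendsto' hd (hi1.add hi2) ht
    rw [integral_add hi1 hi2, integral_const_mul, integral_const_mul, ih] at h
    simp only [Complex.ofReal_zero, zero_pow (Nat.succ_ne_zero N), zero_mul, sub_zero] at h
    have h2 : α * ∫ x : ℝ in Ioi 0, (x : ℂ) ^ (N + 1) * Complex.exp (-α * x) =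
        (N + 1 : ℂ) * (N.factorial / α ^ (N + 1)) := by linear_combination -h
    rw [Nat.factorial_succ, eq_div_iff (pow_ne_zero _ hα0), pow_succ α (N + 1)]
    push_cast
    calc _ = α ^ (N + 1) * (α * ∫ x : ℝ in Ioi 0, (x : ℂ) ^ (N + 1) * Complex.exp (-α * x)) := by
          ring
      _ = _ := by
          rw [h2]
          field_simp

theorem integrable_of_summable_integral_norm {X : Type*} [MeasurableSpace X] {μ : Measure X}
    {f : ℕ → X → ℂ} {F : X → ℂ} (hf : ∀ i, Integrable (f i) μ)
    (hs : Summable fun i => ∫ x, ‖f i x‖ ∂μ) (hF : ∀ᵐ x ∂μ, HasSum (fun i => f i x) (F x)) :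
    Integrable F μ := by
  refine ⟨aestronglyMeasurable_of_tendsto_ae Filter.atTop
    (f := fun n x => ∑ i ∈ Finset.range n, f i x)
    (fun n => (integrable_finsetSum _ fun i _ => hf i).aestronglyMeasurable)
    (hF.mono fun x hx => hx.tendsto_sum_nat), ?_⟩
  calc ∫⁻ x, ‖F x‖ₑ ∂μ ≤ ∫⁻ x, ∑' i, ‖f i x‖ₑ ∂μ := by
        refine lintegral_mono_ae (hF.mono fun x hx => ?_)
        rw [← hx.tsum_eq]
        exact enorm_tsum_le_tsum_enorm
    _ = ∑' i, ∫⁻ x, ‖f i x‖ₑ ∂μ := lintegral_tsum fun i => (hf i).aestronglyMeasurable.enorm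
    _ = ∑' i, ENNReal.ofReal (∫ x, ‖f i x‖ ∂μ) := by
        simp_rw [ofReal_integral_norm_eq_lintegral_enorm (hf _)]
    _ < ⊤ := hs.tsum_ofReal_lt_top

/-- Termwise Laplace transform of a power series whose coefficients satisfy
`∑ |c_N| N! / (Re α)^(N+1) < ∞`. -/
theorem laplace_power_series {α : ℂ} (hα : 0 < α.re) {c : ℕ → ℂ} {F : ℝ → ℂ}
    (hc : Summable fun N : ℕ => ‖c N‖ * (N.factorial / α.re ^ (N + 1)))
    (hF : ∀ x : ℝ, 0 < x → HasSum (fun N : ℕ => c N * (x : ℂ) ^ N) (F x)) :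
    IntegrableOn (fun x : ℝ => Complex.exp (-α * x) * F x) (Ioi 0) ∧
      HasSum (fun N : ℕ => c N * (N.factorial / α ^ (N + 1)))
        (∫ x : ℝ in Ioi 0, Complex.exp (-α * x) * F x) := by
  have hi : ∀ N, IntegrableOn (fun x : ℝ => c N * ((x : ℂ) ^ N * Complex.exp (-α * x))) (Ioi 0) :=
    fun N => (integrableOn_pow_mul_cexp_neg_mul hα N).const_mul _
  have hn : ∀ N, ∫ x : ℝ in Ioi 0, ‖c N * ((x : ℂ) ^ N * Complex.exp (-α * x))‖ =
      ‖c N‖ * (N.factorial / α.re ^ (N + 1)) := fun N => by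
    rw [← integral_pow_mul_exp_neg_mul hα, ← integral_const_mul]
    refine setIntegral_congr_fun measurableSet_Ioi fun x hx => ?_
    rw [norm_mul, norm_pow_mul_cexp α N (le_of_lt hx)]
  have hs : ∀ x ∈ Ioi (0 : ℝ), HasSum (fun N => c N * ((x : ℂ) ^ N * Complex.exp (-α * x)))
      (Complex.exp (-α * x) * F x) := fun x hx => by
    refine ((hF x hx).mul_left _).congr_fun fun N => ?_
    ring
  have hs' := (ae_restrict_mem (μ := volume) (measurableSet_Ioi (a := (0 : ℝ)))).mono hs
  have hsum := hc.congr fun N => (hn N).symm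
  refine ⟨integrable_of_summable_integral_norm hi hsum hs', ?_⟩
  have h := hasSum_integral_of_summable_integral_norm hi hsum
  rw [integral_congr_ae (hs'.mono fun x hx => hx.tsum_eq)] at h
  refine h.congr_fun fun N => ?_
  rw [integral_const_mul, integral_pow_mul_cexp_neg_mul hα]

/-! ### The product of three Bessel functions -/

/-- The coefficient of `x^N` in the product of the series `∑ aᵏ xᵏ / k!²`, `∑ bᵏ xᵏ / k!²` and
`∑ cᵏ xᵏ / k!²`, where `J₀(β √x)` corresponds to `∑ aᵏ (-x)ᵏ / k!²` with `a = (β / 2)²`. It is the sum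
over `i + j + k = N`, written as a Cauchy product with the index `j` of `b` outermost. -/
noncomputable def besselTripleCoeff (a b c : ℂ) (N : ℕ) : ℂ :=
  ∑ j ∈ Finset.range (N + 1), b ^ j / (j.factorial : ℂ) ^ 2 *
    ∑ i ∈ Finset.range (N - j + 1), a ^ i / (i.factorial : ℂ) ^ 2 *
      (c ^ (N - j - i) / ((N - j - i).factorial : ℂ) ^ 2)

theorem besselJ_zero_term (β : ℂ) {x : ℝ} (hx : 0 ≤ x) (k : ℕ) :
    (-1 : ℂ) ^ k / ((k.factorial : ℂ) * ((0 + k).factorial : ℂ)) *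
      (β * Real.sqrt x / 2) ^ (0 + 2 * k) =
    ((β / 2) ^ 2) ^ k / (k.factorial : ℂ) ^ 2 * (-(x : ℂ)) ^ k := by
  have h : (β * Real.sqrt x / 2) ^ 2 = (β / 2) ^ 2 * x := by
    have h1 : ((Real.sqrt x : ℝ) : ℂ) ^ 2 = x := by
      rw [← Complex.ofReal_pow, Real.sq_sqrt hx]
    rw [← h1]
    ring
  rw [zero_add, zero_add, pow_mul, h, mul_pow, neg_pow (x : ℂ)]
  ring

theorem hasSum_besselJ_triple (β₁ β₂ β₃ : ℂ) {x : ℝ} (hx : 0 ≤ x) :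
    HasSum (fun N : ℕ => (-1) ^ N *
        besselTripleCoeff ((β₁ / 2) ^ 2) ((β₂ / 2) ^ 2) ((β₃ / 2) ^ 2) N * (x : ℂ) ^ N)
      (besselJ 0 (β₁ * Real.sqrt x) * besselJ 0 (β₂ * Real.sqrt x) *
        besselJ 0 (β₃ * Real.sqrt x)) := by
  have hs : ∀ β : ℂ, Summable fun k : ℕ =>
      ‖((β / 2) ^ 2) ^ k / (k.factorial : ℂ) ^ 2 * (-(x : ℂ)) ^ k‖ := fun β => by
    simp_rw [← besselJ_zero_term β hx]
    exact summable_norm_besselJ 0 _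
  have hJ : ∀ β : ℂ, besselJ 0 (β * Real.sqrt x) =
      ∑' k : ℕ, ((β / 2) ^ 2) ^ k / (k.factorial : ℂ) ^ 2 * (-(x : ℂ)) ^ k := fun β => by
    simp_rw [← besselJ_zero_term β hx]
    rfl
  have h13 := hasSum_sum_range_mul_of_summable_norm (hs β₁) (hs β₃)
  have h := hasSum_sum_range_mul_of_summable_norm (hs β₂)
    (summable_norm_sum_mul_range_of_summable_norm (hs β₁) (hs β₃))
  rw [h13.tsum_eq, ← hJ, ← hJ, ← hJ] at h
  rw [mul_right_comm, mul_comm]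
  refine h.congr_fun fun N => ?_
  rw [besselTripleCoeff, Finset.mul_sum, Finset.sum_mul]
  refine Finset.sum_congr rfl fun j hj => ?_
  rw [Finset.mul_sum, Finset.mul_sum, Finset.mul_sum, Finset.sum_mul]
  refine Finset.sum_congr rfl fun i hi => ?_
  obtain ⟨k, hk⟩ : ∃ k, N = j + i + k := ⟨N - j - i, by
    have := Finset.mem_range.mp hj
    have := Finset.mem_range.mp hi
    omega⟩
  have hk' : N - j - i = k := by omega
  rw [hk', neg_pow (x : ℂ) j, neg_pow (x : ℂ) i, neg_pow (x : ℂ) k, hk]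
  ring

/-- The coefficients of the triple product are the moments of `S S'` on the torus divided by `N!²`. -/
theorem torus_integral_eq_coeff (u v w : ℂ) (N : ℕ) :
    ∫ p : UnitAddCircle × UnitAddCircle,
        ((u * circlePoint p.1 + v * circlePoint p.2 + w) *
          (u * (circlePoint p.1)⁻¹ + v * (circlePoint p.2)⁻¹ + w)) ^ N
        ∂(AddCircle.haarAddCircle.prod AddCircle.haarAddCircle) =
      (N.factorial : ℂ) ^ 2 * besselTripleCoeff (u ^ 2) (v ^ 2) (w ^ 2) N := by
  rw [torus_integral_trinomial, besselTripleCoeff, Finset.mul_sum]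
  refine Finset.sum_congr rfl fun j hj => ?_
  rw [Finset.mul_sum, Finset.mul_sum, Finset.mul_sum]
  refine Finset.sum_congr rfl fun i hi => ?_
  rw [Nat.cast_choose ℂ (Nat.lt_succ_iff.mp (Finset.mem_range.mp hj)),
    Nat.cast_choose ℂ (Nat.lt_succ_iff.mp (Finset.mem_range.mp hi))]
  have h := fun n : ℕ => Nat.cast_ne_zero (R := ℂ).mpr n.factorial_ne_zero
  have h1 := h j
  have h2 := h i
  have h3 := h (N - j)
  have h4 := h (N - j - i)
  field_simp

theorem norm_circle_form_le (u v w : ℂ) (p : UnitAddCircle × UnitAddCircle) :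
    ‖(u * circlePoint p.1 + v * circlePoint p.2 + w) *
          (u * (circlePoint p.1)⁻¹ + v * (circlePoint p.2)⁻¹ + w)‖ ≤ (‖u‖ + ‖v‖ + ‖w‖) ^ 2 := by
  rw [norm_mul, pow_two]
  gcongr
  · refine (norm_add₃_le).trans ?_
    rw [norm_mul, norm_mul, norm_circlePoint, norm_circlePoint, mul_one, mul_one]
  · refine (norm_add₃_le).trans ?_
    rw [norm_mul, norm_mul, norm_inv, norm_inv, norm_circlePoint, norm_circlePoint, inv_one,
      mul_one, mul_one]

/-- The moment formula bounds the coefficients well enough for the Laplace transform to be taken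
term by term. -/
theorem norm_besselTripleCoeff_le (u v w : ℂ) (N : ℕ) :
    ‖besselTripleCoeff (u ^ 2) (v ^ 2) (w ^ 2) N‖ ≤
      ((‖u‖ + ‖v‖ + ‖w‖) ^ 2) ^ N / (N.factorial : ℝ) ^ 2 := by
  have h : ‖∫ p : UnitAddCircle × UnitAddCircle,
        ((u * circlePoint p.1 + v * circlePoint p.2 + w) *
          (u * (circlePoint p.1)⁻¹ + v * (circlePoint p.2)⁻¹ + w)) ^ N
        ∂(AddCircle.haarAddCircle.prod AddCircle.haarAddCircle)‖ ≤
      ((‖u‖ + ‖v‖ + ‖w‖) ^ 2) ^ N * _ := norm_integral_le_of_norm_le_const (ae_of_all _ fun p => by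
    rw [norm_pow]
    exact pow_le_pow_left₀ (norm_nonneg _) (norm_circle_form_le u v w p) N)
  rw [torus_integral_eq_coeff, probReal_univ, mul_one, norm_mul, norm_pow,
    Complex.norm_natCast] at h
  rwa [le_div_iff₀ (by positivity), mul_comm]

/-- The torus average of `exp (-S S' / α)`, expanded in the moments of `S S'`. -/
theorem hasSum_torus_exp_neg (u v w α : ℂ) :
    HasSum (fun N : ℕ => (-1) ^ N * besselTripleCoeff (u ^ 2) (v ^ 2) (w ^ 2) N *
        (N.factorial / α ^ N))
      (∫ p : UnitAddCircle × UnitAddCircle,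
        Complex.exp (-((u * circlePoint p.1 + v * circlePoint p.2 + w) *
          (u * (circlePoint p.1)⁻¹ + v * (circlePoint p.2)⁻¹ + w) / α))
        ∂(AddCircle.haarAddCircle.prod AddCircle.haarAddCircle)) := by
  have h := hasSum_integral_of_norm_le_summable
    ((AddCircle.haarAddCircle (T := (1 : ℝ))).prod (AddCircle.haarAddCircle (T := (1 : ℝ))))
    (b := fun N : ℕ => ((‖u‖ + ‖v‖ + ‖w‖) ^ 2 / ‖α‖) ^ N / N.factorial)
    (f := fun (N : ℕ) p => (-1) ^ N / (α ^ N * N.factorial) *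
      ((u * circlePoint p.1 + v * circlePoint p.2 + w) *
          (u * (circlePoint p.1)⁻¹ + v * (circlePoint p.2)⁻¹ + w)) ^ N)
    (F := fun p => Complex.exp (-((u * circlePoint p.1 + v * circlePoint p.2 + w) *
          (u * (circlePoint p.1)⁻¹ + v * (circlePoint p.2)⁻¹ + w) / α)))
    (fun N => ?_) (Real.summable_pow_div_factorial _) (fun N p => ?_) (fun p => ?_)
  · refine h.congr_fun fun N => ?_
    rw [integral_const_mul, torus_integral_eq_coeff]
    have h1 := Nat.cast_ne_zero (R := ℂ).mpr N.factorial_ne_zero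
    field_simp
  · exact continuous_const.mul ((continuous_circle_form u v w).pow N)
  · calc ‖(-1) ^ N / (α ^ N * N.factorial) *
          ((u * circlePoint p.1 + v * circlePoint p.2 + w) *
            (u * (circlePoint p.1)⁻¹ + v * (circlePoint p.2)⁻¹ + w)) ^ N‖
        = 1 / (‖α‖ ^ N * N.factorial) * ‖(u * circlePoint p.1 + v * circlePoint p.2 + w) *
            (u * (circlePoint p.1)⁻¹ + v * (circlePoint p.2)⁻¹ + w)‖ ^ N := by
          rw [norm_mul, norm_div, norm_mul, norm_pow, norm_pow, norm_pow, norm_neg, norm_one,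
            one_pow, Complex.norm_natCast]
      _ ≤ 1 / (‖α‖ ^ N * N.factorial) * ((‖u‖ + ‖v‖ + ‖w‖) ^ 2) ^ N :=
          mul_le_mul_of_nonneg_left
            (pow_le_pow_left₀ (norm_nonneg _) (norm_circle_form_le u v w p) N) (by positivity)
      _ = ((‖u‖ + ‖v‖ + ‖w‖) ^ 2 / ‖α‖) ^ N / N.factorial := by
          rw [div_pow, div_div, one_div_mul_eq_div]
  · refine (hasSum_exp _).congr_fun fun N => ?_
    rw [neg_pow (_ / _), div_pow]
    ring

/-- The Laplace transform of the triple product is a torus average of a Gaussian, because both sides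
have the same expansion in the moments of `S S'`. -/
theorem bessel_triple_laplace (β₁ β₂ β₃ : ℂ) {α : ℂ} (hα : 0 < α.re) :
    IntegrableOn
        (fun x : ℝ => Complex.exp (-α * x) * (besselJ 0 (β₁ * Real.sqrt x) *
          besselJ 0 (β₂ * Real.sqrt x) * besselJ 0 (β₃ * Real.sqrt x))) (Ioi 0) ∧
      ∫ x : ℝ in Ioi 0, Complex.exp (-α * x) * (besselJ 0 (β₁ * Real.sqrt x) *
          besselJ 0 (β₂ * Real.sqrt x) * besselJ 0 (β₃ * Real.sqrt x)) =
        1 / α * ∫ p : UnitAddCircle × UnitAddCircle,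
          Complex.exp (-((β₁ / 2 * circlePoint p.1 + β₂ / 2 * circlePoint p.2 + β₃ / 2) *
            (β₁ / 2 * (circlePoint p.1)⁻¹ + β₂ / 2 * (circlePoint p.2)⁻¹ + β₃ / 2) / α))
          ∂(AddCircle.haarAddCircle.prod AddCircle.haarAddCircle) := by
  have hc : Summable fun N : ℕ => ‖(-1) ^ N *
      besselTripleCoeff ((β₁ / 2) ^ 2) ((β₂ / 2) ^ 2) ((β₃ / 2) ^ 2) N‖ *
        (N.factorial / α.re ^ (N + 1)) := by
    refine Summable.of_nonneg_of_le (fun N => by positivity) (fun N => ?_)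
      ((Real.summable_pow_div_factorial
        ((‖β₁ / 2‖ + ‖β₂ / 2‖ + ‖β₃ / 2‖) ^ 2 / α.re)).mul_left (1 / α.re))
    rw [norm_mul, norm_pow, norm_neg, norm_one, one_pow, one_mul]
    refine (mul_le_mul_of_nonneg_right (norm_besselTripleCoeff_le _ _ _ N)
      (by positivity)).trans_eq ?_
    have h1 := Nat.cast_ne_zero (R := ℝ).mpr N.factorial_ne_zero
    rw [div_pow, pow_succ α.re N]
    field_simp
  obtain ⟨h1, h2⟩ := laplace_power_series hα hc
    fun x hx => hasSum_besselJ_triple β₁ β₂ β₃ hx.le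
  refine ⟨h1, h2.unique ?_⟩
  refine ((hasSum_torus_exp_neg (β₁ / 2) (β₂ / 2) (β₃ / 2) α).mul_left (1 / α)).congr_fun
    fun N => ?_
  rw [pow_succ, one_div]
  ring

/-- Folding an even summable family on `ℤ` to `ℕ` produces the weights `2 - δ₀ₙ`. -/
theorem hasSum_nat_of_even_int {f : ℤ → ℂ} (hf : ∀ n, f (-n) = f n) {m : ℂ} (h : HasSum f m) :
    HasSum (fun n : ℕ => (2 - if n = 0 then 1 else 0) * f n) m := by
  have h1 := h.nat_add_neg.sub (hasSum_ite_eq 0 (f 0))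
  rw [add_sub_cancel_right] at h1
  refine h1.congr_fun fun n => ?_
  by_cases hn : n = 0
  · subst hn
    simp
    ring
  · rw [if_neg hn, if_neg hn, hf]
    ring

/-- The torus average of `exp (-S S' / α)` as a series of triple products of modified Bessel
functions: the diagonal terms of `S S'` give the exponential prefactor and the cross terms give the
three generating functions. -/
theorem hasSum_bessel_triple (β₁ β₂ β₃ α : ℂ) (hα : α ≠ 0) :
    HasSum (fun n : ℕ => Complex.exp (-(β₁ ^ 2 + β₂ ^ 2 + β₃ ^ 2) / (4 * α)) *
        ((-1 : ℂ) ^ n * (2 - if n = 0 then 1 else 0) *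
        (besselI n (β₁ * β₂ / (2 * α)) * besselI n (β₁ * β₃ / (2 * α)) *
          besselI n (β₂ * β₃ / (2 * α)))))
      (∫ p : UnitAddCircle × UnitAddCircle,
          Complex.exp (-((β₁ / 2 * circlePoint p.1 + β₂ / 2 * circlePoint p.2 + β₃ / 2) *
            (β₁ / 2 * (circlePoint p.1)⁻¹ + β₂ / 2 * (circlePoint p.2)⁻¹ + β₃ / 2) / α))
          ∂(AddCircle.haarAddCircle.prod AddCircle.haarAddCircle)) := by
  have h := (hasSum_nat_of_even_int (fun n => by
    rw [Int.natAbs_neg, zpow_neg, ← inv_zpow, inv_neg, inv_one])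
      (hasSum_torus_integral_exp (β₁ * β₂ / (2 * α)) (β₁ * β₃ / (2 * α))
        (β₂ * β₃ / (2 * α)))).mul_left (Complex.exp (-(β₁ ^ 2 + β₂ ^ 2 + β₃ ^ 2) / (4 * α)))
  rw [← integral_const_mul] at h
  have he : ∀ p : UnitAddCircle × UnitAddCircle,
      Complex.exp (-((β₁ / 2 * circlePoint p.1 + β₂ / 2 * circlePoint p.2 + β₃ / 2) *
            (β₁ / 2 * (circlePoint p.1)⁻¹ + β₂ / 2 * (circlePoint p.2)⁻¹ + β₃ / 2) / α)) =
      Complex.exp (-(β₁ ^ 2 + β₂ ^ 2 + β₃ ^ 2) / (4 * α)) *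
        (Complex.exp (-(β₁ * β₂ / (2 * α) / 2 * (circlePoint p.1 * (circlePoint p.2)⁻¹ +
            (circlePoint p.1 * (circlePoint p.2)⁻¹)⁻¹))) *
        (Complex.exp (-(β₁ * β₃ / (2 * α) / 2 * (circlePoint p.1 + (circlePoint p.1)⁻¹))) *
        Complex.exp (-(β₂ * β₃ / (2 * α) / 2 * (circlePoint p.2 + (circlePoint p.2)⁻¹))))) :=
      fun p => by
    rw [← Complex.exp_add, ← Complex.exp_add, ← Complex.exp_add]
    congr 1
    have h1 := circlePoint_ne_zero p.1
    have h2 := circlePoint_ne_zero p.2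
    field_simp
    ring
  simp_rw [he]
  refine h.congr_fun fun n => ?_
  rw [Int.natAbs_natCast, zpow_natCast]
  ring

/-! ### Evaluation of the integrals -/

theorem besselJ_zero_zero : besselJ 0 0 = 1 := by
  rw [besselJ, tsum_eq_single 0]
  · simp
  · intro k hk
    simp [hk]

theorem besselI_zero_right (n : ℕ) : besselI n 0 = if n = 0 then 1 else 0 := by
  rw [besselI, tsum_eq_single 0]
  · by_cases hn : n = 0 <;> simp [hn]
  · intro k hk
    simp [hk]

theorem bessel_triple (α β₁ β₂ β₃ : ℂ) (hα : 0 < α.re) :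
    IntegrableOn
        (fun x : ℝ => Complex.exp (-α * x) * besselJ 0 (β₁ * Real.sqrt x) *
          besselJ 0 (β₂ * Real.sqrt x) * besselJ 0 (β₃ * Real.sqrt x)) (Ioi 0) ∧
      Summable (fun n : ℕ => (-1 : ℂ) ^ n * (2 - if n = 0 then 1 else 0) *
        (besselI n (β₁ * β₂ / (2 * α)) * besselI n (β₁ * β₃ / (2 * α)) *
          besselI n (β₂ * β₃ / (2 * α)))) ∧
      ∫ x : ℝ in Ioi 0, Complex.exp (-α * x) * besselJ 0 (β₁ * Real.sqrt x) *
          besselJ 0 (β₂ * Real.sqrt x) * besselJ 0 (β₃ * Real.sqrt x) =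
        1 / α * Complex.exp (-(β₁ ^ 2 + β₂ ^ 2 + β₃ ^ 2) / (4 * α)) *
          ∑' n : ℕ, (-1 : ℂ) ^ n * (2 - if n = 0 then 1 else 0) *
            (besselI n (β₁ * β₂ / (2 * α)) * besselI n (β₁ * β₃ / (2 * α)) *
              besselI n (β₂ * β₃ / (2 * α))) := by
  have hα0 : α ≠ 0 := fun h => by simp [h] at hα
  obtain ⟨h1, h2⟩ := bessel_triple_laplace β₁ β₂ β₃ hα
  have h3 := hasSum_bessel_triple β₁ β₂ β₃ α hα0
  simp only [← mul_assoc (Complex.exp (-α * _))] at h1 h2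
  refine ⟨h1, (summable_mul_left_iff (Complex.exp_ne_zero _)).mp h3.summable, ?_⟩
  rw [h2, ← h3.tsum_eq, tsum_mul_left, mul_assoc (1 / α)]

/-- Order zero of Weber's second exponential integral, from the triple integral at `β₃ = 0`, where the
series reduces to its term `n = 0`, and the substitution `x ↦ x²`. -/
theorem weber_second_zero (α β₁ β₂ : ℂ) (hα : 0 < α.re) :
    IntegrableOn
        (fun x : ℝ => (x : ℂ) * Complex.exp (-α * x ^ 2) * besselJ 0 (β₁ * x) *
          besselJ 0 (β₂ * x)) (Ioi 0) ∧
      ∫ x : ℝ in Ioi 0, (x : ℂ) * Complex.exp (-α * x ^ 2) * besselJ 0 (β₁ * x) *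
          besselJ 0 (β₂ * x) =
        1 / (2 * α) * Complex.exp (-(β₁ ^ 2 + β₂ ^ 2) / (4 * α)) *
          besselI 0 (β₁ * β₂ / (2 * α)) := by
  obtain ⟨h1, -, h2⟩ := bessel_triple α β₁ β₂ 0 hα
  simp only [zero_mul, besselJ_zero_zero, mul_one] at h1 h2
  have hser : ∑' n : ℕ, (-1 : ℂ) ^ n * (2 - if n = 0 then 1 else 0) *
      (besselI n (β₁ * β₂ / (2 * α)) * besselI n (β₁ * 0 / (2 * α)) *
        besselI n (β₂ * 0 / (2 * α))) = besselI 0 (β₁ * β₂ / (2 * α)) := by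
    rw [tsum_eq_single 0]
    · simp [besselI_zero_right]
      norm_num
    · intro n hn
      simp [besselI_zero_right, hn]
  rw [hser, zero_pow two_ne_zero, add_zero] at h2
  set g : ℝ → ℂ := fun x => Complex.exp (-α * x) * besselJ 0 (β₁ * Real.sqrt x) *
    besselJ 0 (β₂ * Real.sqrt x) with hg
  have heq : ∀ x ∈ Ioi (0 : ℝ), ((2 : ℝ) * x ^ ((2 : ℝ) - 1)) • g (x ^ (2 : ℝ)) =
      2 * ((x : ℂ) * Complex.exp (-α * x ^ 2) * besselJ 0 (β₁ * x) * besselJ 0 (β₂ * x)) :=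
      fun x hx => by
    have hx0 : (0 : ℝ) ≤ x := le_of_lt hx
    rw [hg, Complex.real_smul]
    norm_num [Real.sqrt_sq hx0]
    ring
  have h4 := (integrableOn_Ioi_comp_rpow_iff g (p := 2) two_ne_zero).mpr h1
  rw [abs_two, integrableOn_congr_fun heq measurableSet_Ioi] at h4
  have h5 := integral_comp_rpow_Ioi_of_pos (g := g) (p := 2) two_pos
  rw [setIntegral_congr_fun measurableSet_Ioi heq, integral_const_mul, h2] at h5
  refine ⟨?_, ?_⟩
  · have h6 := h4.const_mul (1 / 2 : ℂ)
    refine h6.congr (ae_of_all _ fun x => ?_)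
    ring
  · rw [← mul_right_inj' (two_ne_zero (α := ℂ)), h5, one_div, one_div, mul_inv]
    ring

theorem mainTheorem2 (α β₁ β₂ β₃ : ℂ) (hα : 0 < α.re) :
    (IntegrableOn
        (fun x : ℝ => Complex.exp (-α * x) * besselJ 0 (β₁ * Real.sqrt x) *
          besselJ 0 (β₂ * Real.sqrt x) * besselJ 0 (β₃ * Real.sqrt x)) (Ioi 0) ∧
      Summable (fun n : ℕ => (-1 : ℂ) ^ n * (2 - if n = 0 then 1 else 0) *
        (besselI n (β₁ * β₂ / (2 * α)) * besselI n (β₁ * β₃ / (2 * α)) *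
          besselI n (β₂ * β₃ / (2 * α)))) ∧
      ∫ x : ℝ in Ioi 0, Complex.exp (-α * x) * besselJ 0 (β₁ * Real.sqrt x) *
          besselJ 0 (β₂ * Real.sqrt x) * besselJ 0 (β₃ * Real.sqrt x) =
        1 / α * Complex.exp (-(β₁ ^ 2 + β₂ ^ 2 + β₃ ^ 2) / (4 * α)) *
          ∑' n : ℕ, (-1 : ℂ) ^ n * (2 - if n = 0 then 1 else 0) *
            (besselI n (β₁ * β₂ / (2 * α)) * besselI n (β₁ * β₃ / (2 * α)) *
              besselI n (β₂ * β₃ / (2 * α)))) ∧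
    (IntegrableOn
        (fun x : ℝ => (x : ℂ) * Complex.exp (-α * x ^ 2) * besselJ 0 (β₁ * x) *
          besselJ 0 (β₂ * x)) (Ioi 0) ∧
      ∫ x : ℝ in Ioi 0, (x : ℂ) * Complex.exp (-α * x ^ 2) * besselJ 0 (β₁ * x) *
          besselJ 0 (β₂ * x) =
        1 / (2 * α) * Complex.exp (-(β₁ ^ 2 + β₂ ^ 2) / (4 * α)) *
          besselI 0 (β₁ * β₂ / (2 * α))) :=
  ⟨bessel_triple α β₁ β₂ β₃ hα, weber_second_zero α β₁ β₂ hα⟩
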